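/- Let $u,v:\mathbb R\to\mathbb R$ be the solutions of the Airy equation $y''=xy$ with $u(0)=1,\ u'(0)=0$ and $v(0)=0,\ v'(0)=1$. For integers $k,j\ge 0$ put $$e_k(j)=-\left(\tfrac32\left(j\pi+\tfrac{k\pi}{6}\right)\right)^{2/3}.$$ Then: 1. For every $j\ge 0$ the function $v'$ has exactly one zero in the open interval $(e_3(j),e_2(j))$, and $v'$ has no real zero outside these intervals. Hence the zeros of $v'$, listed in strictly decreasing order, form an infinite sequence $-c_0>-c_2>-c_4>\cdots$, and $-c_{2j}\in(e_3(j),e_2(j))$ for every $j\ge0$. 2. For every $j\ge 0$ the function $u$ has exactly one zero in the open interval $(e_4(j),e_3(j))$, and $u$ has no real zero outside these intervals. Hence the zeros of $u$, listed in strictly decreasing order, form an infinite sequence $-\tilde c_0>-\tilde c_2>-\tilde c_4>\cdots$, and $-\tilde c_{2j}\in(e_4(j),e_3(j))$ for every $j\ge0$. 3. For every $j\ge 0$ the function $v$ has exactly one zero in the open interval $(e_6(j),e_5(j))$, and apart from the zero $x=0$ it has no real zero outside these intervals. Hence the nonzero zeros of $v$, listed in strictly decreasing order, form an infinite sequence of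 negative numbers $-c_1>-c_3>-c_5>\cdots$, and $-c_{2j+1}\in(e_6(j),e_5(j))$ for every $j\ge0$. 4. For every $j\ge 0$ the function $u'$ has exactly one zero in the open interval $(e_7(j),e_6(j))$, and apart from the zero $x=0$ it has no real zero outside these intervals. Hence the nonzero zeros of $u'$, listed in strictly decreasing order, form an infinite sequence of negative numbers $-\tilde c_1>-\tilde c_3>-\tilde c_5>\cdots$, and $-\tilde c_{2j+1}\in(e_7(j),e_6(j))$ for every $j\ge0$. Consequently $-\tilde c_p<-c_p$ for every $p\ge 0$. -/

import Mathlib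

/-- `y` is a (twice differentiable, real) solution on the whole line of the Airy equation
`y'' = x y`. -/
def IsAirySolution (y : ℝ → ℝ) : Prop :=
  Differentiable ℝ y ∧ ∀ x : ℝ, HasDerivAt (deriv y) (x * y x) x

namespace AiryAux

/-- Coefficients of the power series solution of `y'' = x y` with `y 0 = a`, `y' 0 = b`. -/
noncomputable def coef (a b : ℝ) : ℕ → ℝ
  | 0 => a
  | 1 => b
  | 2 => 0
  | n + 3 => coef a b n / ((n + 2) * (n + 3))

/-- The coefficient sequence `s` defines an everywhere convergent power series. -/
def Entire (s : ℕ → ℝ) : Prop := ∀ R : ℝ, 0 ≤ R → Summable fun n => |s n| * R ^ n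

theorem Entire.deriv {s : ℕ → ℝ} (hs : Entire s) :
    Entire fun n => ((n : ℝ) + 1) * s (n + 1) := by
  intro R hR
  have h := (summable_nat_add_iff 1).2 (hs (2 * (R + 1)) (by positivity))
  refine Summable.of_nonneg_of_le (fun n => by positivity) (fun n => ?_) h
  have h1 : ((n : ℝ) + 1) ≤ 2 ^ (n + 1) := by
    exact_mod_cast (Nat.lt_two_pow_self (n := n + 1)).le
  have h2 : R ^ n ≤ (R + 1) ^ (n + 1) :=
    (pow_le_pow_left₀ hR (by linarith) n).trans (pow_le_pow_right₀ (by linarith) (by omega))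
  rw [abs_mul, abs_of_nonneg (by positivity : (0 : ℝ) ≤ (n : ℝ) + 1), mul_pow]
  calc ((n : ℝ) + 1) * |s (n + 1)| * R ^ n
      ≤ 2 ^ (n + 1) * |s (n + 1)| * (R + 1) ^ (n + 1) := by gcongr
    _ = _ := by ring

theorem Entire.summable {s : ℕ → ℝ} (hs : Entire s) (x : ℝ) :
    Summable fun n => s n * x ^ n := by
  refine Summable.of_norm ?_
  simpa [abs_mul, abs_pow] using hs |x| (abs_nonneg x)

theorem Entire.hasDerivAt {s : ℕ → ℝ} (hs : Entire s) (x : ℝ) :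
    HasDerivAt (fun x => ∑' n, s n * x ^ n)
      (∑' n : ℕ, (((n : ℝ) + 1) * s (n + 1)) * x ^ n) x := by
  set R : ℝ := |x| + 1 with hR
  have hR0 : 0 ≤ R := by positivity
  have hd := hs.deriv R hR0
  have hsum : Summable fun n : ℕ => |s n| * (n * R ^ (n - 1)) := by
    refine (summable_nat_add_iff 1).1 (hd.congr fun n => ?_)
    rw [abs_mul, abs_of_nonneg (by positivity : (0 : ℝ) ≤ (n : ℝ) + 1)]
    rw [Nat.add_sub_cancel]
    push_cast
    ring
  have key := hasDerivAt_tsum_of_isPreconnected (𝕜 := ℝ) (t := Metric.ball 0 R)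
    (g := fun n x => s n * x ^ n) (g' := fun n x => s n * (n * x ^ (n - 1))) hsum
    Metric.isOpen_ball (convex_ball 0 R).isPreconnected
    (fun n y _ => (hasDerivAt_pow n y).const_mul (s n))
    (fun n y hy => by
      have hy' : |y| ≤ R := by
        have := mem_ball_zero_iff.1 hy
        exact this.le
      rw [Real.norm_eq_abs, abs_mul, abs_mul, abs_pow, Nat.abs_cast]
      gcongr)
    (Metric.mem_ball_self (by positivity)) (hs.summable 0)
    (y := x) (by simp [hR])
  refine key.congr_deriv ?_
  have hs' : Summable fun n : ℕ => s n * (n * x ^ (n - 1)) := by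
    refine (summable_nat_add_iff 1).1 ((hs.deriv.summable x).congr fun n => ?_)
    rw [Nat.add_sub_cancel]
    push_cast
    ring
  rw [hs'.tsum_eq_zero_add]
  simp only [Nat.cast_zero, zero_mul, mul_zero, zero_add]
  refine tsum_congr fun n => ?_
  rw [Nat.add_sub_cancel]
  push_cast
  ring

theorem coef_entire (a b : ℝ) : Entire (coef a b) := by
  intro R hR
  have key : ∀ k n, |coef a b (n + 3 * k)| ≤ |coef a b n| / k.factorial := by
    intro k
    induction k with
    | zero => intro n; simp
    | succ k ih =>
      intro n
      rw [show n + 3 * (k + 1) = (n + 3 * k) + 3 by ring, coef, abs_div, Nat.factorial_succ]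
      have h1 : ((k : ℝ) + 1) ≤ |(((n + 3 * k : ℕ) : ℝ) + 2) * (((n + 3 * k : ℕ) : ℝ) + 3)| := by
        rw [abs_of_nonneg (by positivity)]
        push_cast
        have : (0 : ℝ) ≤ n := by positivity
        have : (0 : ℝ) ≤ k := by positivity
        nlinarith [mul_nonneg ‹(0 : ℝ) ≤ n› ‹(0 : ℝ) ≤ k›]
      calc _ ≤ (|coef a b n| / k.factorial) / ((k : ℝ) + 1) := by
            gcongr
            exact ih n
        _ = _ := by
            push_cast
            field_simp
  have main : ∀ r, Summable fun k : ℕ => |coef a b (r + 3 * k)| * R ^ (r + 3 * k) := by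
    intro r
    refine Summable.of_nonneg_of_le (fun k => by positivity) (fun k => ?_)
      ((Real.summable_pow_div_factorial (R ^ 3)).mul_left (|coef a b r| * R ^ r))
    calc _ ≤ (|coef a b r| / k.factorial) * R ^ (r + 3 * k) := by
          gcongr
          exact key k r
      _ = _ := by rw [pow_add, pow_mul]; ring
  rw [← (Nat.divModEquiv 3).symm.summable_iff, ← (Equiv.prodComm (Fin 3) ℕ).summable_iff]
  refine (summable_prod_of_nonneg (fun p => by
    simp only [Function.comp, Pi.zero_apply]; positivity)).2
    ⟨fun r => ?_, (hasSum_fintype _).summable⟩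
  refine (main r).congr fun k => ?_
  simp [Nat.divModEquiv, add_comm, mul_comm]

theorem exists_solution (a b : ℝ) :
    ∃ y : ℝ → ℝ, IsAirySolution y ∧ y 0 = a ∧ deriv y 0 = b := by
  have h0 := coef_entire a b
  have h1 := h0.deriv
  have hd : deriv (fun x => ∑' n, coef a b n * x ^ n) =
      fun x => ∑' n : ℕ, (((n : ℝ) + 1) * coef a b (n + 1)) * x ^ n :=
    funext fun x => (h0.hasDerivAt x).deriv
  refine ⟨fun x => ∑' n, coef a b n * x ^ n,
    ⟨fun x => (h0.hasDerivAt x).differentiableAt, fun x => ?_⟩, ?_, ?_⟩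
  · rw [hd]
    refine (h1.hasDerivAt x).congr_deriv ?_
    rw [(h1.deriv.summable x).tsum_eq_zero_add, ← tsum_mul_left]
    simp only [coef, mul_zero, zero_mul, zero_add, Nat.cast_zero]
    refine tsum_congr fun n => ?_
    push_cast
    field_simp
    ring
  · show ∑' n, coef a b n * (0 : ℝ) ^ n = a
    rw [tsum_eq_single 0 (fun n hn => by simp [hn])]
    simp [coef]
  · rw [hd]
    show ∑' n : ℕ, (((n : ℝ) + 1) * coef a b (n + 1)) * (0 : ℝ) ^ n = b
    rw [tsum_eq_single 0 (fun n hn => by simp [hn])]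
    simp [coef]

theorem wronskian_const {y z : ℝ → ℝ} (hy : IsAirySolution y) (hz : IsAirySolution z) (x : ℝ) :
    y x * deriv z x - deriv y x * z x = y 0 * deriv z 0 - deriv y 0 * z 0 := by
  have h : ∀ x, HasDerivAt (fun x => y x * deriv z x - deriv y x * z x) 0 x := by
    intro x
    refine (((hy.1 x).hasDerivAt.mul (hz.2 x)).sub
      ((hy.2 x).mul (hz.1 x).hasDerivAt)).congr_deriv ?_
    ring
  exact is_const_of_deriv_eq_zero (fun x => (h x).differentiableAt) (fun x => (h x).deriv) x 0

end AiryAux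

/-- The initial value problem for the Airy equation has exactly one global solution. -/
theorem existsUnique_airySolution (a b : ℝ) :
    ∃! y : ℝ → ℝ, IsAirySolution y ∧ y 0 = a ∧ deriv y 0 = b := by
  obtain ⟨y, hy, hy0, hy1⟩ := AiryAux.exists_solution a b
  refine ⟨y, ⟨hy, hy0, hy1⟩, ?_⟩
  rintro z ⟨hz, hz0, hz1⟩
  obtain ⟨u, hu, hu0, hu1⟩ := AiryAux.exists_solution 1 0
  obtain ⟨v, hv, hv0, hv1⟩ := AiryAux.exists_solution 0 1
  funext x
  have e1 := AiryAux.wronskian_const hy hu x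
  have e2 := AiryAux.wronskian_const hy hv x
  have e3 := AiryAux.wronskian_const hz hu x
  have e4 := AiryAux.wronskian_const hz hv x
  have e5 := AiryAux.wronskian_const hu hv x
  rw [hy0, hy1, hu0, hu1] at e1
  rw [hy0, hy1, hv0, hv1] at e2
  rw [hz0, hz1, hu0, hu1] at e3
  rw [hz0, hz1, hv0, hv1] at e4
  rw [hu0, hu1, hv0, hv1] at e5
  linear_combination (y x - z x) * e5 + u x * (e4 - e2) - v x * (e3 - e1)

/-- The canonical solution `u` of the Airy equation, with `u 0 = 1` and `u' 0 = 0`. -/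
noncomputable def airyU : ℝ → ℝ := (existsUnique_airySolution 1 0).choose

/-- The canonical solution `v` of the Airy equation, with `v 0 = 0` and `v' 0 = 1`. -/
noncomputable def airyV : ℝ → ℝ := (existsUnique_airySolution 0 1).choose

theorem airyU_spec : IsAirySolution airyU ∧ airyU 0 = 1 ∧ deriv airyU 0 = 0 :=
  (existsUnique_airySolution 1 0).choose_spec.1

theorem airyV_spec : IsAirySolution airyV ∧ airyV 0 = 0 ∧ deriv airyV 0 = 1 :=
  (existsUnique_airySolution 0 1).choose_spec.1

/-- For `f` with infinitely many negative zeros, without finite accumulation point,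
`-(negZeroSeq f 0) > -(negZeroSeq f 1) > ...` are the negative zeros of `f` in decreasing order. -/
noncomputable def negZeroSeq (f : ℝ → ℝ) : ℕ → ℝ
  | 0 => sInf {x : ℝ | 0 < x ∧ f (-x) = 0}
  | j + 1 => sInf {x : ℝ | negZeroSeq f j < x ∧ f (-x) = 0}

/-- The sequence `c`: `-c (2 * j)` are the negative zeros of `v'`, and `-c (2 * j + 1)` the negative
zeros of `v`, both in decreasing order. -/
noncomputable def airyC (p : ℕ) : ℝ :=
  if Even p then negZeroSeq (deriv airyV) (p / 2) else negZeroSeq airyV (p / 2)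

/-- The sequence `c̃`: `-c̃ (2 * j)` are the negative zeros of `u`, and `-c̃ (2 * j + 1)` the negative
zeros of `u'`, both in decreasing order. -/
noncomputable def airyCTilde (p : ℕ) : ℝ :=
  if Even p then negZeroSeq airyU (p / 2) else negZeroSeq (deriv airyU) (p / 2)

/-- `endpt k j = -((3/2) (j π + k π / 6)) ^ (2/3)`. -/
noncomputable def endpt (k j : ℕ) : ℝ :=
  -((3 / 2 : ℝ) * (j * Real.pi + k * Real.pi / 6)) ^ (2 / 3 : ℝ)

/-!
On the negative half line the Airy equation is compared with the sine. For `x = -t` put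
`s = (2/3) t ^ (3/2)`; then `endpt k j` is the point `x` with `s = j π + k π / 6`. For a solution `y`,
the functions `w = y (-t)` and `q = -y' (-t)`, as functions of `s`, solve `w' = q / √t`,
`q' = -√t w` (`AirySystem`). With `p = √t w` this becomes `p' = q + p / (3 s)`, `q' = -p`, a
perturbation of the system for `(sin, cos)`. Moreover `s ^ (-1/6) p` and `s ^ (-1/6) q` solve
`g'' + (1 + 5 / (36 s ^ 2)) g = 0` and `g'' + (1 - 7 / (36 s ^ 2)) g = 0`. Four Sturm comparisons,
each by the monotonicity of one explicit Wronskian, follow: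

* from a zero of `w` to the next zero of `q` it is less than `π / 2` (`snd_neg_of_quarter`),
* from a zero of `q` to the next zero of `w` it is more than `π / 2` (`quarter_lt_of_fst_eq_zero`),
* consecutive zeros of `w` are less than `π` apart (`fst_neg_of_half`),
* consecutive zeros of `q` are more than `π` apart (`half_lt_of_snd_eq_zero`).

All four hold from the singular point `s = 0` on. Hence an upper bound for one zero of `w` propagates
to all later ones with period `π`, a lower bound for one zero of `q` likewise, and the quarter-period
comparisons turn these into lower bounds for the zeros of `w` and upper bounds for those of `q`.
So everything is reduced to the first zeros. For `v` one needs that the first zero of `q` exceeds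
`π / 3` (`pi_div_three_lt_of_arch`), while `w` already vanishes at `s = 0`. For `u` one needs that the
first zero of `w` is less than `2 π / 3` (`exists_fst_nonpos`), while `q` already vanishes at `s = 0`.
The resulting intervals are disjoint and each contains exactly one zero. On the positive half line
there are no zeros, as `y y'` increases there from the value `0` at the origin.
-/

namespace AiryZeros

open Set Filter Topology Real

/-! ### Preliminaries from real analysis -/

/-- A continuous function that is positive at `a` and not at `b` has a first zero in `(a, b]`. -/
theorem exists_first_zero {f : ℝ → ℝ} (hf : Continuous f) {a b : ℝ} (ha : 0 < f a)
    (hb : f b ≤ 0) (hab : a ≤ b) : ∃ c ∈ Ioc a b, f c = 0 ∧ ∀ x ∈ Ico a c, 0 < f x := by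
  have hK : IsCompact (Icc a b ∩ f ⁻¹' {0}) :=
    isCompact_Icc.inter_right (isClosed_singleton.preimage hf)
  obtain ⟨z, hz, hz0⟩ := intermediate_value_Icc' hab hf.continuousOn ⟨hb, ha.le⟩
  obtain ⟨c, ⟨hc, hc0⟩, hmin⟩ := hK.exists_isLeast ⟨z, hz, hz0⟩
  have hc0 : f c = 0 := hc0
  have hac : a < c := lt_of_le_of_ne hc.1 (by rintro rfl; exact ha.ne' hc0)
  refine ⟨c, ⟨hac, hc.2⟩, hc0, fun x hx => ?_⟩
  by_contra! hx0
  obtain ⟨y, hy, hy0⟩ := intermediate_value_Icc' hx.1 hf.continuousOn ⟨hx0, ha.le⟩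
  have := hmin ⟨⟨hy.1, hy.2.trans (hx.2.le.trans hc.2)⟩, hy0⟩
  exact absurd (this.trans hy.2) (not_le.2 hx.2)

/-- A strictly decreasing function with a majorant that tends to `0` at the left end point is negative.
No continuity at that end point is needed: the Wronskians below may be singular at `0`. -/
theorem neg_of_strictAntiOn_of_le {D E : ℝ → ℝ} {a b e : ℝ} (hab : a < b) (hae : a < e)
    (hD : StrictAntiOn D (Ioc a b)) (hE : Tendsto E (𝓝[>] a) (𝓝 0))
    (hDE : ∀ s ∈ Ioo a e, D s ≤ E s) : D b < 0 := by
  have hm : (a + b) / 2 ∈ Ioc a b := ⟨by linarith, by linarith⟩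
  refine (hD hm (right_mem_Ioc.2 hab) (by linarith)).trans_le ?_
  refine ge_of_tendsto hE ?_
  have h1 : Ioo a (min e ((a + b) / 2)) ∈ 𝓝[>] a :=
    Ioo_mem_nhdsGT (lt_min hae hm.1)
  filter_upwards [h1] with s hs
  refine le_trans (hD ⟨hs.1, ?_⟩ hm ?_).le (hDE s ⟨hs.1, hs.2.trans_le (min_le_left _ _)⟩)
  · linarith [hs.2.trans_le (min_le_right _ _), hm.2]
  · exact hs.2.trans_le (min_le_right _ _)

theorem tendsto_const_mul_rpow_sub (C a : ℝ) {r : ℝ} (hr : 0 < r) :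
    Tendsto (fun s : ℝ => C * (s - a) ^ r) (𝓝[>] a) (𝓝 0) := by
  have hc : Continuous fun s : ℝ => C * (s - a) ^ r :=
    continuous_const.mul ((continuous_id.sub continuous_const).rpow_const fun _ => Or.inr hr.le)
  have := hc.tendsto a
  simp only [sub_self, zero_rpow hr.ne', mul_zero] at this
  exact this.mono_left nhdsWithin_le_nhds

theorem hasDerivAt_cos_sub (a s : ℝ) :
    HasDerivAt (fun s => cos (s - a)) (-sin (s - a)) s := by
  simpa using ((hasDerivAt_id s).sub_const a).cos

theorem hasDerivAt_sin_sub (a s : ℝ) :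
    HasDerivAt (fun s => sin (s - a)) (cos (s - a)) s := by
  simpa using ((hasDerivAt_id s).sub_const a).sin

theorem hasDerivAt_rpow_neg_sixth {s : ℝ} (hs : 0 < s) :
    HasDerivAt (fun s : ℝ => s ^ (-(1 / 6) : ℝ)) (-(s ^ (-(1 / 6) : ℝ) / (6 * s))) s := by
  refine (hasDerivAt_rpow_const (p := -(1 / 6)) (Or.inl hs.ne')).congr_deriv ?_
  rw [rpow_sub_one hs.ne']
  field_simp

/-! ### The Liouville variable -/

/-- The inverse of the Liouville variable `s = (2/3) t ^ (3/2)` on `[0, ∞)`, so that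
`endpt k j = -liouville (j π + k π / 6)`. -/
noncomputable def liouville (s : ℝ) : ℝ := (3 / 2 * s) ^ (2 / 3 : ℝ)

/-- The square root of `liouville s`, for `0 ≤ s`. -/
noncomputable def root (s : ℝ) : ℝ := (3 / 2 * s) ^ (1 / 3 : ℝ)

theorem root_pos {s : ℝ} (hs : 0 < s) : 0 < root s := by
  unfold root; positivity

theorem root_nonneg {s : ℝ} (hs : 0 ≤ s) : 0 ≤ root s := by
  unfold root; positivity

theorem root_zero : root 0 = 0 := by
  simp [root]

theorem liouville_zero : liouville 0 = 0 := by
  simp [liouville]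

theorem root_pow_three {s : ℝ} (hs : 0 ≤ s) : root s ^ 3 = 3 / 2 * s := by
  unfold root
  rw [← rpow_natCast, ← rpow_mul (by positivity)]
  norm_num

theorem root_sq {s : ℝ} (hs : 0 ≤ s) : root s ^ 2 = liouville s := by
  unfold root liouville
  rw [← rpow_natCast, ← rpow_mul (by positivity)]
  norm_num

theorem root_le_root {s t : ℝ} (hs : 0 ≤ s) (h : s ≤ t) : root s ≤ root t :=
  rpow_le_rpow (by positivity) (by linarith) (by norm_num)

theorem continuous_root : Continuous root :=
  (continuous_const.mul continuous_id).rpow_const fun _ => Or.inr (by norm_num)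

theorem continuous_liouville : Continuous liouville :=
  (continuous_const.mul continuous_id).rpow_const fun _ => Or.inr (by norm_num)

theorem hasDerivAt_root {s : ℝ} (hs : 0 < s) : HasDerivAt root (root s / (3 * s)) s := by
  have h := ((hasDerivAt_id s).const_mul (3 / 2 : ℝ)).rpow_const (p := 1 / 3)
    (Or.inl (by simp; positivity))
  refine h.congr_deriv ?_
  simp only [id]
  rw [rpow_sub_one (by positivity)]
  unfold root
  field_simp

theorem hasDerivAt_liouville {s : ℝ} (hs : 0 < s) : HasDerivAt liouville (1 / root s) s := by
  have h := ((hasDerivAt_id s).const_mul (3 / 2 : ℝ)).rpow_const (p := 2 / 3)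
    (Or.inl (by simp; positivity))
  refine h.congr_deriv ?_
  simp only [id]
  unfold root
  rw [show (2 / 3 - 1 : ℝ) = -(1 / 3) by norm_num, rpow_neg (by positivity)]
  field_simp

theorem liouville_lt_liouville {s t : ℝ} (hs : 0 ≤ s) (h : s < t) : liouville s < liouville t :=
  rpow_lt_rpow (by positivity) (by linarith) (by norm_num)

theorem liouville_pos {s : ℝ} (hs : 0 < s) : 0 < liouville s := by
  unfold liouville; positivity

theorem exists_liouville_eq {t : ℝ} (ht : 0 < t) : ∃ s, 0 < s ∧ liouville s = t := by
  refine ⟨2 / 3 * t ^ (3 / 2 : ℝ), by positivity, ?_⟩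
  unfold liouville
  rw [show 3 / 2 * (2 / 3 * t ^ (3 / 2 : ℝ)) = t ^ (3 / 2 : ℝ) by ring, ← rpow_mul ht.le]
  norm_num

/-! ### The first-order system -/

/-- The Airy equation on the negative half line as a first-order system in the Liouville variable:
for a solution `y`, the functions `w s = y (-t)` and `q s = -y' (-t)` with `t = liouville s`
satisfy `w' = q / √t` and `q' = -√t w`. -/
structure AirySystem (w q : ℝ → ℝ) : Prop where
  cont_fst : Continuous w
  cont_snd : Continuous q
  deriv_fst : ∀ s, 0 < s → HasDerivAt w (q s / root s) s
  deriv_snd : ∀ s, 0 < s → HasDerivAt q (-(root s * w s)) s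

theorem airySystem_of_isAirySolution {y : ℝ → ℝ} (hy : IsAirySolution y) :
    AirySystem (fun s => y (-liouville s)) (fun s => -deriv y (-liouville s)) := by
  refine ⟨hy.1.continuous.comp continuous_liouville.neg, ?_, fun s hs => ?_, fun s hs => ?_⟩
  · have : Continuous (deriv y) :=
      continuous_iff_continuousAt.2 fun x => (hy.2 x).continuousAt
    exact (this.comp continuous_liouville.neg).neg
  · refine ((hy.1 _).hasDerivAt.comp s (hasDerivAt_liouville hs).neg).congr_deriv ?_
    rw [Pi.neg_apply]
    ring
  · refine (((hy.2 _).comp s (hasDerivAt_liouville hs).neg).neg).congr_deriv ?_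
    rw [Pi.neg_apply, ← root_sq hs.le]
    have := (root_pos hs).ne'
    field_simp

namespace AirySystem

variable {w q : ℝ → ℝ}

theorem const_mul (h : AirySystem w q) (c : ℝ) :
    AirySystem (fun s => c * w s) (fun s => c * q s) :=
  ⟨h.cont_fst.const_smul c, h.cont_snd.const_smul c,
    fun s hs => ((h.deriv_fst s hs).const_mul c).congr_deriv (by ring),
    fun s hs => ((h.deriv_snd s hs).const_mul c).congr_deriv (by ring)⟩

theorem hasDerivAt_root_mul (h : AirySystem w q) {s : ℝ} (hs : 0 < s) :
    HasDerivAt (fun s => root s * w s) (q s + root s * w s / (3 * s)) s := by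
  refine ((hasDerivAt_root hs).mul (h.deriv_fst s hs)).congr_deriv ?_
  have := (root_pos hs).ne'
  field_simp
  ring

theorem continuous_root_mul (h : AirySystem w q) : Continuous fun s => root s * w s :=
  continuous_root.mul h.cont_fst

/-- `w` increases where `q` is positive. -/
theorem strictMonoOn_fst (h : AirySystem w q) {a b : ℝ} (ha : 0 ≤ a)
    (hq : ∀ s ∈ Ioo a b, 0 < q s) : StrictMonoOn w (Icc a b) := by
  refine strictMonoOn_of_deriv_pos (convex_Icc a b) h.cont_fst.continuousOn fun s hs => ?_
  rw [interior_Icc] at hs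
  have hs0 : 0 < s := ha.trans_lt hs.1
  rw [(h.deriv_fst s hs0).deriv]
  exact div_pos (hq s hs) (root_pos hs0)

/-- `q` decreases where `w` is positive. -/
theorem strictAntiOn_snd (h : AirySystem w q) {a b : ℝ} (ha : 0 ≤ a)
    (hw : ∀ s ∈ Ioo a b, 0 < w s) : StrictAntiOn q (Icc a b) := by
  refine strictAntiOn_of_deriv_neg (convex_Icc a b) h.cont_snd.continuousOn fun s hs => ?_
  rw [interior_Icc] at hs
  have hs0 : 0 < s := ha.trans_lt hs.1
  rw [(h.deriv_snd s hs0).deriv]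
  exact neg_neg_of_pos (mul_pos (root_pos hs0) (hw s hs))

end AirySystem

/-! ### Comparison with trigonometric functions -/

namespace AirySystem

variable {w q : ℝ → ℝ}

/-- After a zero `a` of `w`, the function `q` cannot stay positive up to `a + π / 2`: with
`p s = root s * w s`, the function `p cos (s - a) - q sin (s - a)` vanishes at `a` and has the
derivative `p cos (s - a) / (3 s) > 0`. -/
theorem snd_neg_of_quarter (h : AirySystem w q) {a : ℝ} (ha : 0 ≤ a) (hwa : w a = 0)
    (hq : ∀ s ∈ Ico a (a + π / 2), 0 < q s) : q (a + π / 2) < 0 := by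
  have hpi := pi_pos
  have hw : ∀ s ∈ Ioc a (a + π / 2), 0 < w s := fun s hs => by
    have := h.strictMonoOn_fst ha (fun x hx => hq x ⟨hx.1.le, hx.2⟩)
      (left_mem_Icc.2 (by linarith)) ⟨hs.1.le, hs.2⟩ hs.1
    rwa [hwa] at this
  have hmono : StrictMonoOn (fun s => root s * w s * cos (s - a) - q s * sin (s - a))
      (Icc a (a + π / 2)) := by
    refine strictMonoOn_of_deriv_pos (convex_Icc _ _) ?_ fun s hs => ?_
    · have := h.continuous_root_mul
      have := h.cont_snd
      fun_prop
    · rw [interior_Icc] at hs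
      have hs0 : 0 < s := ha.trans_lt hs.1
      have hd := ((h.hasDerivAt_root_mul hs0).mul (hasDerivAt_cos_sub a s)).sub
        ((h.deriv_snd s hs0).mul (hasDerivAt_sin_sub a s))
      have hc : 0 < cos (s - a) := cos_pos_of_mem_Ioo ⟨by linarith [hs.1], by linarith [hs.2]⟩
      have hp := mul_pos (root_pos hs0) (hw s ⟨hs.1, hs.2.le⟩)
      have : 0 < root s * w s / (3 * s) * cos (s - a) := by positivity
      refine lt_of_lt_of_eq this ((hd.congr_deriv ?_).deriv.symm)
      ring
  have := hmono (left_mem_Icc.2 (by linarith)) (right_mem_Icc.2 (by linarith))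
    (show a < a + π / 2 by linarith)
  simp [hwa] at this
  linarith

/-- A zero `b` of `q` and the next zero of `w` are more than `π / 2` apart: with
`p s = root s * w s`, the function `q cos (s - b) + p sin (s - b)` vanishes at `b` and has the
derivative `p sin (s - b) / (3 s) > 0`. -/
theorem quarter_lt_of_fst_eq_zero (h : AirySystem w q) {b c : ℝ} (hb : 0 ≤ b) (hqb : q b = 0)
    (hbc : b < c) (hw : ∀ s ∈ Ico b c, 0 < w s) (hwc : w c = 0) : b + π / 2 < c := by
  by_contra! hcon
  have hqc : q c < 0 := by
    have := h.strictAntiOn_snd hb (fun x hx => hw x ⟨hx.1.le, hx.2⟩)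
      (left_mem_Icc.2 hbc.le) (right_mem_Icc.2 hbc.le) hbc
    rwa [hqb] at this
  have hmono : StrictMonoOn (fun s => q s * cos (s - b) + root s * w s * sin (s - b))
      (Icc b c) := by
    refine strictMonoOn_of_deriv_pos (convex_Icc _ _) ?_ fun s hs => ?_
    · have := h.continuous_root_mul
      have := h.cont_snd
      fun_prop
    · rw [interior_Icc] at hs
      have hs0 : 0 < s := hb.trans_lt hs.1
      have hd := ((h.deriv_snd s hs0).mul (hasDerivAt_cos_sub b s)).add
        ((h.hasDerivAt_root_mul hs0).mul (hasDerivAt_sin_sub b s))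
      have hc : 0 < sin (s - b) :=
        sin_pos_of_pos_of_lt_pi (by linarith [hs.1]) (by linarith [hs.2, pi_pos])
      have hp := mul_pos (root_pos hs0) (hw s ⟨hs.1.le, hs.2⟩)
      have : 0 < root s * w s / (3 * s) * sin (s - b) := by positivity
      refine lt_of_lt_of_eq this ((hd.congr_deriv ?_).deriv.symm)
      ring
  have := hmono (left_mem_Icc.2 hbc.le) (right_mem_Icc.2 hbc.le) hbc
  simp only [hqb, hwc, sub_self, sin_zero, zero_mul, mul_zero, add_zero] at this
  have hc : 0 ≤ cos (c - b) := cos_nonneg_of_mem_Icc ⟨by linarith [pi_pos], by linarith⟩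
  nlinarith

/-- The Wronskian of `g s = s ^ (-1/6) * (root s * w s)` and `sin (s - a)`. As
`g'' = -(1 + 5 / (36 s ^ 2)) g`, solutions oscillate faster here than the sine. -/
theorem hasDerivAt_fst_wronskian (h : AirySystem w q) (a : ℝ) {s : ℝ} (hs : 0 < s) :
    HasDerivAt (fun s => s ^ (-(1 / 6) : ℝ) *
      ((q s + root s * w s / (6 * s)) * sin (s - a) - root s * w s * cos (s - a)))
      (-(5 / (36 * s ^ 2) * s ^ (-(1 / 6) : ℝ) * (root s * w s) * sin (s - a))) s := by
  have hp := h.hasDerivAt_root_mul hs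
  have h6 : HasDerivAt (fun s : ℝ => 6 * s) 6 s := by
    simpa using (hasDerivAt_id s).const_mul (6 : ℝ)
  have hd := (hasDerivAt_rpow_neg_sixth hs).mul
    ((((h.deriv_snd s hs).add (hp.div h6 (by positivity))).mul (hasDerivAt_sin_sub a s)).sub
      (hp.mul (hasDerivAt_cos_sub a s)))
  refine hd.congr_deriv ?_
  simp only [Pi.add_apply, Pi.sub_apply, Pi.mul_apply, Pi.div_apply]
  field_simp
  ring

/-- The Wronskian of `g s = s ^ (-1/6) * q s` and `sin (s - b)`. As
`g'' = -(1 - 7 / (36 s ^ 2)) g`, solutions oscillate more slowly here than the sine. -/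
theorem hasDerivAt_snd_wronskian (h : AirySystem w q) (b : ℝ) {s : ℝ} (hs : 0 < s) :
    HasDerivAt (fun s => s ^ (-(1 / 6) : ℝ) *
      ((-(root s * w s) - q s / (6 * s)) * sin (s - b) - q s * cos (s - b)))
      (7 / (36 * s ^ 2) * s ^ (-(1 / 6) : ℝ) * q s * sin (s - b)) s := by
  have hp := h.hasDerivAt_root_mul hs
  have hq := h.deriv_snd s hs
  have h6 : HasDerivAt (fun s : ℝ => 6 * s) 6 s := by
    simpa using (hasDerivAt_id s).const_mul (6 : ℝ)
  have hd := (hasDerivAt_rpow_neg_sixth hs).mul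
    (((hp.neg.sub (hq.div h6 (by positivity))).mul (hasDerivAt_sin_sub b s)).sub
      (hq.mul (hasDerivAt_cos_sub b s)))
  refine hd.congr_deriv ?_
  simp only [Pi.sub_apply, Pi.mul_apply, Pi.div_apply, Pi.neg_apply]
  field_simp
  ring

/-- If `w` stays positive on a whole interval of length `π` after its zero `a`, then it is negative at
the end, contrary to continuity: so the next zero of `w` comes before `a + π`. The hypotheses on `q`
near `a` make the Wronskian tend to `0` there, also for `a = 0`. -/
theorem fst_neg_of_half (h : AirySystem w q) {a b : ℝ} (ha : 0 ≤ a) (hwa : w a = 0)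
    (hab : a < b) (hb : b ≤ a + π / 2) (hq : ∀ s ∈ Ico a b, 0 < q s)
    (hw : ∀ s ∈ Ioo a (a + π), 0 < w s) : w (a + π) < 0 := by
  have hpi := pi_pos
  have hanti : StrictAntiOn (fun s => s ^ (-(1 / 6) : ℝ) *
      ((q s + root s * w s / (6 * s)) * sin (s - a) - root s * w s * cos (s - a)))
      (Ioc a (a + π)) := by
    refine strictAntiOn_of_deriv_neg (convex_Ioc _ _) (fun s hs =>
      (h.hasDerivAt_fst_wronskian a (ha.trans_lt hs.1)).continuousAt.continuousWithinAt)
      fun s hs => ?_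
    rw [interior_Ioc] at hs
    have hs0 : 0 < s := ha.trans_lt hs.1
    rw [(h.hasDerivAt_fst_wronskian a hs0).deriv]
    have hc : 0 < sin (s - a) :=
      sin_pos_of_pos_of_lt_pi (by linarith [hs.1]) (by linarith [hs.2])
    have hp := mul_pos (root_pos hs0) (hw s hs)
    have : 0 < 5 / (36 * s ^ 2) * s ^ (-(1 / 6) : ℝ) * (root s * w s) * sin (s - a) := by
      positivity
    linarith
  have hqa : 0 < q a := hq a ⟨le_rfl, hab⟩
  -- near `a` the function `q` is at most `q a`, and hence `w` at most `q a * liouville`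
  have hqle : ∀ s ∈ Ico a b, q s ≤ q a := fun s hs =>
    (h.strictAntiOn_snd ha (b := b) fun x hx => hw x ⟨hx.1, by linarith [hx.2]⟩).antitoneOn
      (left_mem_Icc.2 hab.le) ⟨hs.1, hs.2.le⟩ hs.1
  have hwle : ∀ s ∈ Ioo a b, w s ≤ q a * liouville s := by
    have hm : MonotoneOn (fun s => q a * liouville s - w s) (Icc a b) := by
      refine monotoneOn_of_deriv_nonneg (convex_Icc _ _) ?_ ?_ fun s hs => ?_
      · have := h.cont_fst
        have := continuous_liouville
        fun_prop
      · intro s hs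
        rw [interior_Icc] at hs
        have hs0 : 0 < s := ha.trans_lt hs.1
        exact (((hasDerivAt_liouville hs0).const_mul (q a)).sub
          (h.deriv_fst s hs0)).differentiableAt.differentiableWithinAt
      · rw [interior_Icc] at hs
        have hs0 : 0 < s := ha.trans_lt hs.1
        have hd := ((hasDerivAt_liouville hs0).const_mul (q a)).sub (h.deriv_fst s hs0)
        refine le_of_le_of_eq (b := (q a - q s) / root s) ?_ ((hd.congr_deriv ?_).deriv.symm)
        · exact div_nonneg (sub_nonneg.2 (hqle s ⟨hs.1.le, hs.2⟩)) (root_nonneg hs0.le)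
        · ring
    intro s hs
    have := hm (left_mem_Icc.2 hab.le) ⟨hs.1.le, hs.2.le⟩ hs.1.le
    have h0 : 0 ≤ q a * liouville a := by
      rw [← root_sq ha]; positivity
    simp only [hwa] at this
    linarith
  have key := neg_of_strictAntiOn_of_le (by linarith) hab hanti
    (tendsto_const_mul_rpow_sub (5 / 4 * q a) a (show (0 : ℝ) < 5 / 6 by norm_num))
    fun s hs => by
      have hs0 : 0 < s := ha.trans_lt hs.1
      have hsa : 0 < s - a := by linarith [hs.1]
      have hr := root_pos hs0
      have hp : root s * w s ≤ 3 / 2 * q a * s := by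
        calc root s * w s ≤ root s * (q a * liouville s) := by gcongr; exact hwle s hs
          _ = q a * root s ^ 3 := by rw [← root_sq hs0.le]; ring
          _ = _ := by rw [root_pow_three hs0.le]; ring
      have hp0 : 0 ≤ root s * w s := (mul_pos hr (hw s ⟨hs.1, by linarith [hs.2]⟩)).le
      have hp6 : root s * w s / (6 * s) ≤ 1 / 4 * q a := by
        rw [div_le_iff₀ (by positivity)]; linarith
      have hq0 := hqle s ⟨hs.1.le, hs.2⟩
      have hc : 0 ≤ cos (s - a) :=
        cos_nonneg_of_mem_Icc ⟨by linarith [hs.1], by linarith [hs.2]⟩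
      have hsin : 0 ≤ sin (s - a) :=
        sin_nonneg_of_nonneg_of_le_pi hsa.le (by linarith [hs.2])
      have h1 : (q s + root s * w s / (6 * s)) * sin (s - a) - root s * w s * cos (s - a)
          ≤ 5 / 4 * q a * (s - a) := by
        have : (q s + root s * w s / (6 * s)) * sin (s - a) ≤ 5 / 4 * q a * (s - a) :=
          mul_le_mul (by linarith) (sin_le hsa.le) hsin (by positivity)
        nlinarith [mul_nonneg hp0 hc]
      have h2 : s ^ (-(1 / 6) : ℝ) ≤ (s - a) ^ (-(1 / 6) : ℝ) :=
        rpow_le_rpow_of_nonpos hsa (by linarith) (by norm_num)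
      calc _ ≤ s ^ (-(1 / 6) : ℝ) * (5 / 4 * q a * (s - a)) := by gcongr
        _ ≤ (s - a) ^ (-(1 / 6) : ℝ) * (5 / 4 * q a * (s - a)) := by gcongr
        _ = 5 / 4 * q a * ((s - a) ^ (-(1 / 6) : ℝ) * (s - a) ^ (1 : ℝ)) := by
          rw [rpow_one]; ring
        _ = _ := by rw [← rpow_add hsa]; norm_num
  have hs0 : 0 < a + π := by linarith
  simp only [add_sub_cancel_left, sin_pi, cos_pi, mul_zero] at key
  have hr := root_pos hs0
  have h3 : 0 < (a + π) ^ (-(1 / 6) : ℝ) := by positivity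
  have h4 : (a + π) ^ (-(1 / 6) : ℝ) * root (a + π) * w (a + π) < 0 := by linarith
  exact neg_of_mul_neg_right h4 (by positivity)

/-- Consecutive zeros `b < d` of `q` are more than `π` apart. The hypothesis on `w` near `b` makes the
Wronskian tend to `0` there, also for `b = 0`. -/
theorem half_lt_of_snd_eq_zero (h : AirySystem w q) {b c d : ℝ} (hb : 0 ≤ b) (hqb : q b = 0)
    (hbc : b < c) (hw : ∀ s ∈ Ico b c, 0 < w s) (hbd : b < d)
    (hq : ∀ s ∈ Ioo b d, q s < 0) (hwd : w d ≤ 0) (hqd : q d = 0) : b + π < d := by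
  by_contra! hcon
  have hpi := pi_pos
  have hanti : StrictAntiOn (fun s => s ^ (-(1 / 6) : ℝ) *
      ((-(root s * w s) - q s / (6 * s)) * sin (s - b) - q s * cos (s - b))) (Ioc b d) := by
    refine strictAntiOn_of_deriv_neg (convex_Ioc _ _) (fun s hs =>
      (h.hasDerivAt_snd_wronskian b (hb.trans_lt hs.1)).continuousAt.continuousWithinAt)
      fun s hs => ?_
    rw [interior_Ioc] at hs
    have hs0 : 0 < s := hb.trans_lt hs.1
    rw [(h.hasDerivAt_snd_wronskian b hs0).deriv]
    have hc : 0 < sin (s - b) :=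
      sin_pos_of_pos_of_lt_pi (by linarith [hs.1]) (by linarith [hs.2])
    have hq' := neg_pos.2 (hq s hs)
    have : 0 < 7 / (36 * s ^ 2) * s ^ (-(1 / 6) : ℝ) * (-q s) * sin (s - b) := by
      positivity
    linarith
  have hwb : 0 < w b := hw b ⟨le_rfl, hbc⟩
  set e := min c (min d (b + π / 2)) with he
  have hbe : b < e := lt_min hbc (lt_min hbd (by linarith))
  have hec : e ≤ c := min_le_left _ _
  have hed : e ≤ d := (min_le_right _ _).trans (min_le_left _ _)
  have hep : e ≤ b + π / 2 := (min_le_right _ _).trans (min_le_right _ _)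
  have hwle : ∀ s ∈ Ioo b e, w s ≤ w b := by
    have hm : AntitoneOn w (Icc b e) := by
      refine antitoneOn_of_deriv_nonpos (convex_Icc _ _) h.cont_fst.continuousOn ?_ fun s hs => ?_
      · intro s hs
        rw [interior_Icc] at hs
        exact (h.deriv_fst s (hb.trans_lt hs.1)).differentiableAt.differentiableWithinAt
      · rw [interior_Icc] at hs
        have hs0 : 0 < s := hb.trans_lt hs.1
        rw [(h.deriv_fst s hs0).deriv]
        exact div_nonpos_of_nonpos_of_nonneg (hq s ⟨hs.1, hs.2.trans_le hed⟩).le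
          (root_nonneg hs0.le)
    exact fun s hs => hm (left_mem_Icc.2 hbe.le) ⟨hs.1.le, hs.2.le⟩ hs.1.le
  -- near `b` the function `w` is at most `w b`, and hence `-q` at most linear in `s - b`
  have hqle : ∀ s ∈ Ioo b e, -q s ≤ root e * w b * (s - b) := by
    have hm : MonotoneOn (fun s => q s + root e * w b * (s - b)) (Icc b e) := by
      have hd : ∀ s, 0 < s → HasDerivAt (fun s => q s + root e * w b * (s - b))
          (root e * w b - root s * w s) s := fun s hs0 => by
        have := (h.deriv_snd s hs0).add
          (((hasDerivAt_id s).sub_const b).const_mul (root e * w b))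
        exact this.congr_deriv (by ring)
      refine monotoneOn_of_deriv_nonneg (convex_Icc _ _) ?_ ?_ fun s hs => ?_
      · have := h.cont_snd
        fun_prop
      · intro s hs
        rw [interior_Icc] at hs
        exact (hd s (hb.trans_lt hs.1)).differentiableAt.differentiableWithinAt
      · rw [interior_Icc] at hs
        have hs0 : 0 < s := hb.trans_lt hs.1
        rw [(hd s hs0).deriv, sub_nonneg]
        exact mul_le_mul (root_le_root hs0.le hs.2.le) (hwle s hs)
          (hw s ⟨hs.1.le, hs.2.trans_le hec⟩).le (root_nonneg (hb.trans hbe.le))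
    intro s hs
    have := hm (left_mem_Icc.2 hbe.le) ⟨hs.1.le, hs.2.le⟩ hs.1.le
    simp only [hqb, sub_self, mul_zero, add_zero] at this
    linarith
  have hC : 0 ≤ root e * w b := mul_nonneg (root_nonneg (hb.trans hbe.le)) hwb.le
  have key := neg_of_strictAntiOn_of_le hbd hbe hanti
    (tendsto_const_mul_rpow_sub (7 / 6 * (root e * w b)) b (show (0 : ℝ) < 5 / 6 by norm_num))
    fun s hs => by
      have hs0 : 0 < s := hb.trans_lt hs.1
      have hsb : 0 < s - b := by linarith [hs.1]
      have hq1 := hqle s hs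
      have hq0 : 0 < -q s := neg_pos.2 (hq s ⟨hs.1, hs.2.trans_le hed⟩)
      have hp0 : 0 < root s * w s := mul_pos (root_pos hs0) (hw s ⟨hs.1.le, hs.2.trans_le hec⟩)
      have hsin : 0 < sin (s - b) :=
        sin_pos_of_pos_of_lt_pi hsb (by linarith [hs.2])
      have h0 : -q s / (6 * s) * sin (s - b) ≤ 1 / 6 * -q s := by
        have : sin (s - b) ≤ s := (sin_le hsb.le).trans (by linarith)
        rw [div_mul_eq_mul_div, div_le_iff₀ (by positivity)]
        nlinarith
      have h1 : (-(root s * w s) - q s / (6 * s)) * sin (s - b) - q s * cos (s - b)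
          ≤ 7 / 6 * (root e * w b) * (s - b) := by
        have h2 : -q s * cos (s - b) ≤ -q s := mul_le_of_le_one_right hq0.le (cos_le_one _)
        have h3 := mul_pos hp0 hsin
        rw [neg_div] at h0
        nlinarith
      have h2 : s ^ (-(1 / 6) : ℝ) ≤ (s - b) ^ (-(1 / 6) : ℝ) :=
        rpow_le_rpow_of_nonpos hsb (by linarith) (by norm_num)
      calc _ ≤ s ^ (-(1 / 6) : ℝ) * (7 / 6 * (root e * w b) * (s - b)) := by gcongr
        _ ≤ (s - b) ^ (-(1 / 6) : ℝ) * (7 / 6 * (root e * w b) * (s - b)) := by gcongr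
        _ = 7 / 6 * (root e * w b) * ((s - b) ^ (-(1 / 6) : ℝ) * (s - b) ^ (1 : ℝ)) := by
          rw [rpow_one]; ring
        _ = _ := by rw [← rpow_add hsb]; norm_num
  have hd0 : 0 < d := hb.trans_lt hbd
  simp only [hqd, zero_div, sub_zero, zero_mul] at key
  have hsin : 0 ≤ sin (d - b) := sin_nonneg_of_nonneg_of_le_pi (by linarith) (by linarith)
  have h3 : 0 ≤ d ^ (-(1 / 6) : ℝ) := by positivity
  have h4 : 0 ≤ -(root d * w d) := by
    rw [← mul_neg]; exact mul_nonneg (root_nonneg hd0.le) (neg_nonneg.2 hwd)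
  exact absurd key (not_lt.2 (mul_nonneg h3 (mul_nonneg h4 hsin)))

end AirySystem

/-! ### Chains of zeros -/

/-- An arch of a solution of the system: `w` is positive between its consecutive zeros `a` and `c`,
and `q` changes sign from positive to negative at `b` and nowhere else in `[a, c]`. -/
structure Arch (w q : ℝ → ℝ) (a b c : ℝ) : Prop where
  lt_mid : a < b
  mid_lt : b < a + π / 2
  mid_add_lt : b + π / 2 < c
  lt_add_pi : c < a + π
  fst_left : w a = 0
  fst_right : w c = 0
  snd_mid : q b = 0
  fst_pos : ∀ s ∈ Ioo a c, 0 < w s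
  snd_pos : ∀ s ∈ Ico a b, 0 < q s
  snd_neg : ∀ s ∈ Ioc b c, q s < 0

theorem Arch.mid_lt_right {w q : ℝ → ℝ} {a b c : ℝ} (h : Arch w q a b c) : b < c := by
  linarith [h.mid_add_lt, pi_pos]

theorem AirySystem.exists_arch {w q : ℝ → ℝ} (h : AirySystem w q) {a : ℝ} (ha : 0 ≤ a)
    (hwa : w a = 0) (hqa : 0 < q a) : ∃ b c, Arch w q a b c := by
  have hpi := pi_pos
  obtain ⟨b, hb, hqb, hqpos⟩ : ∃ b ∈ Ioo a (a + π / 2), q b = 0 ∧ ∀ s ∈ Ico a b, 0 < q s := by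
    have hle : ∃ d ∈ Icc a (a + π / 2), q d ≤ 0 := by
      by_contra! hcon
      have := h.snd_neg_of_quarter ha hwa fun s hs => hcon s ⟨hs.1, hs.2.le⟩
      linarith [hcon (a + π / 2) ⟨by linarith, le_rfl⟩]
    obtain ⟨d, hd, hqd⟩ := hle
    obtain ⟨b, hb, hqb, hqpos⟩ := exists_first_zero h.cont_snd hqa hqd hd.1
    refine ⟨b, ⟨hb.1, lt_of_le_of_ne (hb.2.trans hd.2) ?_⟩, hqb, hqpos⟩
    rintro rfl
    exact (h.snd_neg_of_quarter ha hwa hqpos).ne hqb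
  have hwpos : ∀ s ∈ Ioc a b, 0 < w s := fun s hs => by
    have := h.strictMonoOn_fst ha (fun x hx => hqpos x ⟨hx.1.le, hx.2⟩)
      (left_mem_Icc.2 hb.1.le) ⟨hs.1.le, hs.2⟩ hs.1
    rwa [hwa] at this
  obtain ⟨c, hc, hwc, hwpos'⟩ : ∃ c ∈ Ioo b (a + π), w c = 0 ∧ ∀ s ∈ Ico b c, 0 < w s := by
    have hle : ∃ d ∈ Icc b (a + π), w d ≤ 0 := by
      by_contra! hcon
      have := h.fst_neg_of_half ha hwa hb.1 hb.2.le hqpos fun s hs => by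
        rcases le_or_gt s b with hsb | hsb
        · exact hwpos s ⟨hs.1, hsb⟩
        · exact hcon s ⟨hsb.le, hs.2.le⟩
      linarith [hcon (a + π) ⟨by linarith [hb.2], le_rfl⟩]
    obtain ⟨d, hd, hwd⟩ := hle
    obtain ⟨c, hc, hwc, hwpos'⟩ :=
      exists_first_zero h.cont_fst (hwpos b ⟨hb.1, le_rfl⟩) hwd hd.1
    refine ⟨c, ⟨hc.1, lt_of_le_of_ne (hc.2.trans hd.2) ?_⟩, hwc, hwpos'⟩
    rintro rfl
    refine (h.fst_neg_of_half ha hwa hb.1 hb.2.le hqpos fun s hs => ?_).ne hwc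
    rcases le_or_gt s b with hsb | hsb
    · exact hwpos s ⟨hs.1, hsb⟩
    · exact hwpos' s ⟨hsb.le, hs.2⟩
  refine ⟨b, c, hb.1, hb.2, h.quarter_lt_of_fst_eq_zero (ha.trans hb.1.le) hqb hc.1 hwpos' hwc,
    hc.2, hwa, hwc, hqb, fun s hs => ?_, hqpos, fun s hs => ?_⟩
  · rcases le_or_gt s b with hsb | hsb
    · exact hwpos s ⟨hs.1, hsb⟩
    · exact hwpos' s ⟨hsb.le, hs.2⟩
  · have := h.strictAntiOn_snd (ha.trans hb.1.le) (fun x hx => hwpos' x ⟨hx.1.le, hx.2⟩)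
      (left_mem_Icc.2 hc.1.le) ⟨hs.1.le, hs.2⟩ hs.1
    rwa [hqb] at this

/-- Consecutive arches of a solution, of alternating sign: `γ 0 < γ 1 < ...` are consecutive zeros
of `w`, and `β j ∈ (γ j, γ (j + 1))` is the zero of `q` between them. -/
def IsChain (w q : ℝ → ℝ) (γ β : ℕ → ℝ) : Prop :=
  ∀ j, Arch (fun s => (-1) ^ j * w s) (fun s => (-1) ^ j * q s) (γ j) (β j) (γ (j + 1))

/-- Each arch ends at a zero of `w` where `q` is negative; there `(-w, -q)` starts the next arch. -/
theorem AirySystem.exists_chain {w q : ℝ → ℝ} (h : AirySystem w q) {a : ℝ} (ha : 0 ≤ a)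
    (hwa : w a = 0) (hqa : 0 < q a) : ∃ γ β : ℕ → ℝ, γ 0 = a ∧ IsChain w q γ β := by
  let S : ℕ → Type := fun j => {x : ℝ // 0 ≤ x ∧ (-1) ^ j * w x = 0 ∧ 0 < (-1) ^ j * q x}
  have step : ∀ j (x : S j), ∃ b, ∃ y : S (j + 1),
      Arch (fun s => (-1) ^ j * w s) (fun s => (-1) ^ j * q s) x.1 b y.1 := by
    rintro j ⟨x, hx, hwx, hqx⟩
    obtain ⟨b, c, hA⟩ := (h.const_mul ((-1) ^ j)).exists_arch hx hwx hqx
    have hc := hA.fst_right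
    have hqc := hA.snd_neg c ⟨hA.mid_lt_right, le_rfl⟩
    refine ⟨b, ⟨c, hx.trans (hA.lt_mid.trans hA.mid_lt_right).le, ?_, ?_⟩, hA⟩
    · rw [pow_succ]; linarith
    · rw [pow_succ]; linarith
  choose b next hA using step
  let z : ∀ j, S j := fun j => Nat.rec ⟨a, ha, by simpa using hwa, by simpa using hqa⟩ next j
  exact ⟨fun j => (z j).1, fun j => b j (z j), rfl, fun j => hA j (z j)⟩

namespace IsChain

variable {w q : ℝ → ℝ} {γ β : ℕ → ℝ}

theorem left_lt (hc : IsChain w q γ β) (j : ℕ) : γ j < γ (j + 1) :=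
  (hc j).lt_mid.trans (hc j).mid_lt_right

theorem strictMono (hc : IsChain w q γ β) : StrictMono γ := strictMono_nat_of_lt_succ hc.left_lt

theorem fst_eq_zero (hc : IsChain w q γ β) (j : ℕ) : w (γ j) = 0 := by
  simpa using (hc j).fst_left

theorem snd_eq_zero (hc : IsChain w q γ β) (j : ℕ) : q (β j) = 0 := by
  simpa using (hc j).snd_mid

theorem left_le (hc : IsChain w q γ β) (j : ℕ) : γ j ≤ γ 0 + j * π := by
  induction j with
  | zero => simp
  | succ j ih => push_cast; linarith [(hc j).lt_add_pi]

theorem add_pi_lt_mid (hc : IsChain w q γ β) (h : AirySystem w q) (h0 : 0 ≤ γ 0) (j : ℕ) :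
    β j + π < β (j + 1) := by
  have h1 := hc j
  have h2 := hc (j + 1)
  have hneg : ∀ x, (-1 : ℝ) ^ (j + 1) * x = -((-1) ^ j * x) := fun x => by ring
  have hγ : 0 ≤ γ j := h0.trans (hc.strictMono.monotone (Nat.zero_le j))
  refine (h.const_mul ((-1) ^ j)).half_lt_of_snd_eq_zero (hγ.trans h1.lt_mid.le) h1.snd_mid
    h1.mid_lt_right (fun s hs => h1.fst_pos s ⟨h1.lt_mid.trans_le hs.1, hs.2⟩)
    (h1.mid_lt_right.trans h2.lt_mid) (fun s hs => ?_) ?_ ?_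
  · rcases le_or_gt s (γ (j + 1)) with hs' | hs'
    · exact h1.snd_neg s ⟨hs.1, hs'⟩
    · have := h2.snd_pos s ⟨hs'.le, hs.2⟩
      simp only [hneg] at this
      linarith
  · have := h2.fst_pos _ ⟨h2.lt_mid, h2.mid_lt_right⟩
    simp only [hneg] at this
    linarith
  · simp [hc.snd_eq_zero]

theorem le_mid (hc : IsChain w q γ β) (h : AirySystem w q) (h0 : 0 ≤ γ 0) (j : ℕ) :
    β 0 + j * π ≤ β j := by
  induction j with
  | zero => simp
  | succ j ih => push_cast; linarith [hc.add_pi_lt_mid h h0 j]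

theorem exists_mem_Ico (hc : IsChain w q γ β) {s : ℝ} (hs : γ 0 ≤ s) :
    ∃ j, s ∈ Ico (γ j) (γ (j + 1)) := by
  have hge : ∀ j : ℕ, γ 0 + j ≤ γ j := fun j => by
    induction j with
    | zero => simp
    | succ j ih => push_cast; linarith [(hc j).mid_add_lt, (hc j).lt_mid, pi_gt_three]
  have hex : ∃ j, s < γ j := by
    obtain ⟨n, hn⟩ := exists_nat_gt (s - γ 0)
    exact ⟨n, by linarith [hge n]⟩
  classical
  obtain ⟨k, hk⟩ : ∃ k, Nat.find hex = k + 1 :=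
    Nat.exists_eq_succ_of_ne_zero fun h => by
      have := Nat.find_spec hex
      rw [h] at this
      exact absurd this (not_lt.2 hs)
  refine ⟨k, not_lt.1 (Nat.find_min hex (by omega)), ?_⟩
  rw [← hk]
  exact Nat.find_spec hex

theorem exists_eq_of_fst_eq_zero (hc : IsChain w q γ β) {s : ℝ} (hs : γ 0 ≤ s) (hw : w s = 0) :
    ∃ j, s = γ j := by
  obtain ⟨j, hj⟩ := hc.exists_mem_Ico hs
  refine ⟨j, ?_⟩
  by_contra hne
  have := (hc j).fst_pos s ⟨lt_of_le_of_ne hj.1 (Ne.symm hne), hj.2⟩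
  simp [hw] at this

theorem exists_eq_of_snd_eq_zero (hc : IsChain w q γ β) {s : ℝ} (hs : γ 0 ≤ s) (hq : q s = 0) :
    ∃ j, s = β j := by
  obtain ⟨j, hj⟩ := hc.exists_mem_Ico hs
  refine ⟨j, ?_⟩
  rcases lt_trichotomy s (β j) with hlt | heq | hgt
  · have := (hc j).snd_pos s ⟨hj.1, hlt⟩
    simp [hq] at this
  · exact heq
  · have := (hc j).snd_neg s ⟨hgt, hj.2.le⟩
    simp [hq] at this

end IsChain

/-! ### The first zeros of the two canonical solutions -/

namespace AirySystem

variable {w q : ℝ → ℝ}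

/-- The first zero `b` of `q` is larger than `π / 3`. In the variable `t = liouville s` the bound
`q ≤ 1` gives `w ≤ t`, hence `q ≥ 1 - t ^ 3 / 3 = 1 - 3 s ^ 2 / 4`. -/
theorem pi_div_three_lt_of_arch (h : AirySystem w q) (hq0 : q 0 = 1)
    {b c : ℝ} (hA : Arch w q 0 b c) : π / 3 < b := by
  have hb := hA.lt_mid
  have hqle : ∀ s ∈ Icc 0 b, q s ≤ 1 := fun s hs => by
    rw [← hq0]
    exact (h.strictAntiOn_snd le_rfl (b := b) fun x hx =>
      hA.fst_pos x ⟨hx.1, hx.2.trans hA.mid_lt_right⟩).antitoneOn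
      (left_mem_Icc.2 hb.le) hs hs.1
  have hwle : MonotoneOn (fun s => liouville s - w s) (Icc 0 b) := by
    have hd : ∀ s, 0 < s → HasDerivAt (fun s => liouville s - w s) ((1 - q s) / root s) s :=
      fun s hs => ((hasDerivAt_liouville hs).sub (h.deriv_fst s hs)).congr_deriv (by ring)
    refine monotoneOn_of_deriv_nonneg (convex_Icc _ _)
      (continuous_liouville.sub h.cont_fst).continuousOn ?_ fun s hs => ?_
    · intro s hs
      rw [interior_Icc] at hs
      exact (hd s hs.1).differentiableAt.differentiableWithinAt
    · rw [interior_Icc] at hs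
      rw [(hd s hs.1).deriv]
      exact div_nonneg (sub_nonneg.2 (hqle s ⟨hs.1.le, hs.2.le⟩)) (root_nonneg hs.1.le)
  have hqge : MonotoneOn (fun s => q s + 3 / 4 * s ^ 2) (Icc 0 b) := by
    have hd : ∀ s, 0 < s → HasDerivAt (fun s => q s + 3 / 4 * s ^ 2)
        (root s * (liouville s - w s)) s := fun s hs => by
      refine ((h.deriv_snd s hs).add ((hasDerivAt_pow 2 s).const_mul (3 / 4))).congr_deriv ?_
      have := root_pow_three hs.le
      rw [← root_sq hs.le]
      norm_num
      linarith
    have := h.cont_snd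
    refine monotoneOn_of_deriv_nonneg (convex_Icc _ _) (by fun_prop) ?_ fun s hs => ?_
    · intro s hs
      rw [interior_Icc] at hs
      exact (hd s hs.1).differentiableAt.differentiableWithinAt
    · rw [interior_Icc] at hs
      rw [(hd s hs.1).deriv]
      have := hwle (left_mem_Icc.2 hb.le) ⟨hs.1.le, hs.2.le⟩ hs.1.le
      simp only [liouville_zero, hA.fst_left, sub_zero] at this
      exact mul_nonneg (root_nonneg hs.1.le) this
  have := hqge (left_mem_Icc.2 hb.le) (right_mem_Icc.2 hb.le) hb.le
  simp only [hq0, hA.snd_mid] at this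
  by_contra! hcon
  nlinarith [pi_lt_d2, pi_pos]

/-- The first zero of `w` is less than `2 π / 3`. The comparison function
`P = 1 - t ^ 3 / 6 + t ^ 6 / 180`, a Taylor polynomial of `w` in `t = liouville s`, satisfies
`P'' + t P = t ^ 7 / 180 > 0`. So the Wronskian of `w` and `P` increases from `0` while `w > 0`,
whereas it is negative at the zero of `P` before `2 π / 3`, where `P' < 0`. -/
theorem exists_fst_nonpos (h : AirySystem w q) (hw0 : w 0 = 1) (hq0 : q 0 = 0) :
    ∃ s ∈ Ioo 0 (2 * π / 3), w s ≤ 0 := by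
  by_contra! hcon
  have hpi := pi_pos
  -- as `t ^ 3 = 9 s ^ 2 / 4`, this is a zero of `P`
  obtain ⟨s, hs, hs0⟩ : ∃ s ∈ Icc 0 (2 * π / 3), 1 - 3 / 8 * s ^ 2 + 9 / 320 * s ^ 4 = 0 := by
    refine intermediate_value_Icc' (f := fun s : ℝ => 1 - 3 / 8 * s ^ 2 + 9 / 320 * s ^ 4)
      (by positivity) (by fun_prop) ⟨?_, by norm_num⟩
    have h1 : 9.85 < π ^ 2 := by nlinarith [pi_gt_d2]
    have h2 : π ^ 2 < 9.93 := by nlinarith [pi_lt_d2]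
    nlinarith
  have hs1 : 0 < s := lt_of_le_of_ne hs.1 (by rintro rfl; norm_num at hs0)
  have hs2 : s ^ 2 < 4.42 := by nlinarith [hs.2, pi_lt_d2]
  have hs3 : s < 2 * π / 3 := lt_of_le_of_ne hs.2 (by
    rintro rfl
    nlinarith [pi_gt_d2, pi_lt_d2])
  have hmono : StrictMonoOn (fun s => w s * (root s * (-(3 / 4) * s + 9 / 80 * s ^ 3))
      - q s * (1 - 3 / 8 * s ^ 2 + 9 / 320 * s ^ 4)) (Icc 0 s) := by
    refine strictMonoOn_of_deriv_pos (convex_Icc _ _) ?_ fun x hx => ?_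
    · have := h.cont_fst
      have := h.cont_snd
      have := continuous_root
      fun_prop
    · rw [interior_Icc] at hx
      have hx0 := hx.1
      have hr := root_pos hx0
      have hw := hcon x ⟨hx.1, hx.2.trans hs3⟩
      have e1 : HasDerivAt (fun s : ℝ => -(3 / 4) * s + 9 / 80 * s ^ 3)
          (-(3 / 4) + 27 / 80 * x ^ 2) x := by
        refine (((hasDerivAt_id x).const_mul (-(3 / 4))).add
          ((hasDerivAt_pow 3 x).const_mul (9 / 80))).congr_deriv ?_
        norm_num
        ring
      have e2 : HasDerivAt (fun s : ℝ => 1 - 3 / 8 * s ^ 2 + 9 / 320 * s ^ 4)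
          (-(3 / 4) * x + 9 / 80 * x ^ 3) x := by
        refine ((((hasDerivAt_pow 2 x).const_mul (3 / 8)).const_sub 1).add
          ((hasDerivAt_pow 4 x).const_mul (9 / 320))).congr_deriv ?_
        norm_num
        ring
      have hd := ((h.deriv_fst x hx0).mul ((hasDerivAt_root hx0).mul e1)).sub
        ((h.deriv_snd x hx0).mul e2)
      have : 0 < root x * w x * (9 / 320 * x ^ 4) := by positivity
      refine lt_of_lt_of_eq this ((hd.congr_deriv ?_).deriv.symm)
      simp only [Pi.mul_apply]
      field_simp
      ring
  have := hmono (left_mem_Icc.2 hs1.le) (right_mem_Icc.2 hs1.le) hs1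
  simp only [hs0, hq0, hw0, root_zero] at this
  have hw := hcon s ⟨hs1, hs3⟩
  have hneg : 0 < 3 / 4 * s - 9 / 80 * s ^ 3 := by nlinarith
  have := mul_pos hw (mul_pos (root_pos hs1) hneg)
  nlinarith

end AirySystem

/-! ### Location of the zeros in the Liouville variable -/

/-- Location of the zeros for the solution with `w 0 = 0`, where `σ j` and `τ j` are the positive
zeros of `w` and `q`. -/
theorem AirySystem.exists_zeros_of_fst_eq_zero {w q : ℝ → ℝ} (h : AirySystem w q)
    (hw0 : w 0 = 0) (hq0 : q 0 = 1) : ∃ σ τ : ℕ → ℝ,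
    (∀ j : ℕ, σ j ∈ Ioo (j * π + 5 * π / 6) (j * π + 6 * π / 6)) ∧ (∀ j, w (σ j) = 0) ∧
    (∀ s, 0 < s → w s = 0 → ∃ j, s = σ j) ∧
    (∀ j : ℕ, τ j ∈ Ioo (j * π + 2 * π / 6) (j * π + 3 * π / 6)) ∧ (∀ j, q (τ j) = 0) ∧
    (∀ s, 0 < s → q s = 0 → ∃ j, s = τ j) := by
  obtain ⟨γ, β, h0, hc⟩ := h.exists_chain le_rfl hw0 (by rw [hq0]; exact one_pos)
  have hA := hc 0
  simp only [pow_zero, one_mul, h0] at hA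
  have hβ0 := h.pi_div_three_lt_of_arch hq0 hA
  have hβ := hc.le_mid h h0.ge
  have hγ := hc.left_le
  rw [h0] at hγ
  refine ⟨fun j => γ (j + 1), β, fun j => ⟨?_, ?_⟩, fun j => hc.fst_eq_zero _, fun s hs hws => ?_,
    fun j => ⟨?_, ?_⟩, hc.snd_eq_zero,
    fun s hs hqs => hc.exists_eq_of_snd_eq_zero (by rw [h0]; exact hs.le) hqs⟩
  · linarith [(hc j).mid_add_lt, hβ j]
  · linarith [(hc j).lt_add_pi, hγ j]
  · obtain ⟨j, rfl⟩ := hc.exists_eq_of_fst_eq_zero (by rw [h0]; exact hs.le) hws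
    cases j with
    | zero => exact absurd h0 hs.ne'
    | succ j => exact ⟨j, rfl⟩
  · linarith [hβ j]
  · linarith [(hc j).mid_lt, hγ j]

/-- Location of the zeros for the solution with `q 0 = 0`, where `σ j` and `τ j` are the positive
zeros of `w` and `q`. -/
theorem AirySystem.exists_zeros_of_snd_eq_zero {w q : ℝ → ℝ} (h : AirySystem w q)
    (hw0 : w 0 = 1) (hq0 : q 0 = 0) : ∃ σ τ : ℕ → ℝ,
    (∀ j : ℕ, σ j ∈ Ioo (j * π + 3 * π / 6) (j * π + 4 * π / 6)) ∧ (∀ j, w (σ j) = 0) ∧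
    (∀ s, 0 < s → w s = 0 → ∃ j, s = σ j) ∧
    (∀ j : ℕ, τ j ∈ Ioo (j * π + 6 * π / 6) (j * π + 7 * π / 6)) ∧ (∀ j, q (τ j) = 0) ∧
    (∀ s, 0 < s → q s = 0 → ∃ j, s = τ j) := by
  obtain ⟨d, hd, hwd⟩ := h.exists_fst_nonpos hw0 hq0
  obtain ⟨a, ha, hwa, hpos⟩ := exists_first_zero h.cont_fst (by rw [hw0]; exact one_pos) hwd hd.1.le
  have hlow := h.quarter_lt_of_fst_eq_zero le_rfl hq0 ha.1 hpos hwa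
  have hqneg : ∀ s ∈ Ioc 0 a, q s < 0 := fun s hs => by
    have := h.strictAntiOn_snd le_rfl (fun x hx => hpos x ⟨hx.1.le, hx.2⟩)
      (left_mem_Icc.2 ha.1.le) ⟨hs.1.le, hs.2⟩ hs.1
    rwa [hq0] at this
  have hqa := hqneg a ⟨ha.1, le_rfl⟩
  have h' := h.const_mul (-1)
  obtain ⟨γ, β, h0, hc⟩ := h'.exists_chain ha.1.le (by simp [hwa]) (by linarith)
  have hA := hc 0
  simp only [pow_zero, one_mul, h0] at hA
  -- the zero of `q` at the origin and `β 0` are consecutive zeros of `q`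
  have hβ0 : 0 + π < β 0 := by
    refine h.half_lt_of_snd_eq_zero le_rfl hq0 ha.1 hpos (ha.1.trans hA.lt_mid) (fun s hs => ?_) ?_
      (by simpa using hA.snd_mid)
    · rcases le_or_gt s a with hsa | hsa
      · exact hqneg s ⟨hs.1, hsa⟩
      · linarith [hA.snd_pos s ⟨hsa.le, hs.2⟩]
    · linarith [hA.fst_pos _ ⟨hA.lt_mid, hA.mid_lt_right⟩]
  have hβ := hc.le_mid h' (by rw [h0]; exact ha.1.le)
  have hγ := hc.left_le
  rw [h0] at hγ
  have had : a < 2 * π / 3 := ha.2.trans_lt hd.2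
  have hγlow : ∀ j : ℕ, j * π + π / 2 < γ j := fun j => by
    cases j with
    | zero => rw [h0]; push_cast; linarith
    | succ j => push_cast; linarith [(hc j).mid_add_lt, hβ j]
  refine ⟨γ, β, fun j => ⟨?_, ?_⟩, fun j => by simpa using hc.fst_eq_zero j, fun s hs hws => ?_,
    fun j => ⟨?_, ?_⟩, fun j => by simpa using hc.snd_eq_zero j, fun s hs hqs => ?_⟩
  · linarith [hγlow j]
  · linarith [hγ j]
  · refine hc.exists_eq_of_fst_eq_zero ?_ (by simp [hws])
    rw [h0]
    by_contra! hlt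
    exact (hpos s ⟨hs.le, hlt⟩).ne' hws
  · linarith [hβ j]
  · linarith [(hc j).mid_lt, hγ j]
  · refine hc.exists_eq_of_snd_eq_zero ?_ (by simp [hqs])
    rw [h0]
    by_contra! hlt
    exact (hqneg s ⟨hs, hlt.le⟩).ne hqs

/-! ### The positive half line -/

/-- On the positive half line neither `y` nor `y'` vanishes, because `(y y')' = y' ^ 2 + x y ^ 2 > 0`. -/
theorem mul_deriv_pos {y : ℝ → ℝ} (hy : IsAirySolution y) (h0 : y 0 * deriv y 0 = 0)
    (hne : ∀ x, y x ≠ 0 ∨ deriv y x ≠ 0) {x : ℝ} (hx : 0 < x) : 0 < y x * deriv y x := by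
  have hd : ∀ x, HasDerivAt (fun x => y x * deriv y x) (deriv y x ^ 2 + x * y x ^ 2) x :=
    fun x => ((hy.1 x).hasDerivAt.mul (hy.2 x)).congr_deriv (by ring)
  have hmono : StrictMonoOn (fun x => y x * deriv y x) (Icc 0 x) := by
    refine strictMonoOn_of_deriv_pos (convex_Icc _ _)
      (fun z _ => (hd z).continuousAt.continuousWithinAt) fun z hz => ?_
    rw [interior_Icc] at hz
    rw [(hd z).deriv]
    have hz0 := hz.1
    rcases hne z with h | h <;> positivity
  have := hmono (left_mem_Icc.2 hx.le) (right_mem_Icc.2 hx.le) hx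
  simpa only [h0] using this

/-- The Wronskian of the two canonical solutions; it rules out a common zero of `y` and `y'`. -/
theorem airy_wronskian (x : ℝ) : airyU x * deriv airyV x - deriv airyU x * airyV x = 1 := by
  rw [AiryAux.wronskian_const airyU_spec.1 airyV_spec.1 x, airyU_spec.2.1, airyU_spec.2.2,
    airyV_spec.2.1, airyV_spec.2.2]
  norm_num

theorem airyU_mul_deriv_pos {x : ℝ} (hx : 0 < x) : 0 < airyU x * deriv airyU x := by
  refine mul_deriv_pos airyU_spec.1 (by rw [airyU_spec.2.2, mul_zero]) (fun z => ?_) hx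
  by_contra! hcon
  have := airy_wronskian z
  simp [hcon.1, hcon.2] at this

theorem airyV_mul_deriv_pos {x : ℝ} (hx : 0 < x) : 0 < airyV x * deriv airyV x := by
  refine mul_deriv_pos airyV_spec.1 (by rw [airyV_spec.2.1, zero_mul]) (fun z => ?_) hx
  by_contra! hcon
  have := airy_wronskian z
  simp [hcon.1, hcon.2] at this

/-! ### Enumeration of the negative zeros -/

theorem negZeroSeq_eq {f : ℝ → ℝ} {t : ℕ → ℝ} (ht : StrictMono t) (ht0 : 0 < t 0)
    (hf : ∀ x, 0 < x → (f (-x) = 0 ↔ ∃ j, x = t j)) (j : ℕ) : negZeroSeq f j = t j := by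
  have hpos : ∀ j, 0 < t j := fun j => ht0.trans_le (ht.monotone (Nat.zero_le j))
  induction j with
  | zero =>
    refine IsLeast.csInf_eq ⟨⟨ht0, (hf _ ht0).2 ⟨0, rfl⟩⟩, ?_⟩
    rintro x ⟨hx, hfx⟩
    obtain ⟨i, rfl⟩ := (hf x hx).1 hfx
    exact ht.monotone (Nat.zero_le i)
  | succ j ih =>
    rw [negZeroSeq, ih]
    refine IsLeast.csInf_eq ⟨⟨ht (Nat.lt_succ_self j), (hf _ (hpos _)).2 ⟨_, rfl⟩⟩, ?_⟩
    rintro x ⟨hx, hfx⟩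
    obtain ⟨i, rfl⟩ := (hf x ((hpos j).trans hx)).1 hfx
    exact ht.monotone (ht.lt_iff_lt.1 hx)

/-- Translation of the location of the zeros in the Liouville variable to the variable of `f`. -/
theorem negative_zeros {f : ℝ → ℝ} {l : ℕ} (hl : 0 < l) {σ : ℕ → ℝ}
    (hσ : ∀ j : ℕ, σ j ∈ Ioo (j * π + l * π / 6) (j * π + (l + 1 : ℕ) * π / 6))
    (h0 : ∀ j, f (-liouville (σ j)) = 0)
    (hf : ∀ s, 0 < s → f (-liouville s) = 0 → ∃ j, s = σ j) :
    (∀ j, ∃! x, x ∈ Ioo (endpt (l + 1) j) (endpt l j) ∧ f x = 0) ∧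
    (∀ x < 0, f x = 0 → ∃ j, x ∈ Ioo (endpt (l + 1) j) (endpt l j)) ∧
    StrictMono (negZeroSeq f) ∧
    (∀ x < 0, f x = 0 → ∃ j, -negZeroSeq f j = x) ∧
    (∀ j, f (-negZeroSeq f j) = 0) ∧
    ∀ j, -negZeroSeq f j ∈ Ioo (endpt (l + 1) j) (endpt l j) := by
  have hpi := pi_pos
  have hlow : ∀ k j : ℕ, (0 : ℝ) ≤ j * π + k * π / 6 := fun k j => by positivity
  have hpos : ∀ j, 0 < σ j := fun j => (hlow l j).trans_lt (hσ j).1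
  have hmono : StrictMono σ := strictMono_nat_of_lt_succ fun j => by
    refine (hσ j).2.trans_le (le_trans ?_ (hσ (j + 1)).1.le)
    push_cast
    linarith
  have hmem : ∀ j, -liouville (σ j) ∈ Ioo (endpt (l + 1) j) (endpt l j) := fun j =>
    ⟨neg_lt_neg (liouville_lt_liouville (hpos j).le (hσ j).2),
      neg_lt_neg (liouville_lt_liouville (hlow l j) (hσ j).1)⟩
  have hzero : ∀ x < 0, f x = 0 → ∃ j, x = -liouville (σ j) := fun x hx hfx => by
    obtain ⟨s, hs, hsx⟩ := exists_liouville_eq (neg_pos.2 hx)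
    obtain ⟨j, rfl⟩ := hf s hs (by rw [hsx, neg_neg, hfx])
    exact ⟨j, by rw [hsx, neg_neg]⟩
  have hT : StrictMono fun j => liouville (σ j) := fun i j hij =>
    liouville_lt_liouville (hpos i).le (hmono hij)
  have hseq : ∀ j, negZeroSeq f j = liouville (σ j) := by
    refine negZeroSeq_eq hT (liouville_pos (hpos 0)) fun x hx => ⟨fun hfx => ?_, ?_⟩
    · obtain ⟨j, hj⟩ := hzero (-x) (neg_neg_of_pos hx) hfx
      exact ⟨j, neg_injective hj⟩
    · rintro ⟨j, rfl⟩
      exact h0 j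
  have hend : ∀ j : ℕ, endpt l j < 0 := fun j =>
    neg_neg_of_pos (liouville_pos (s := j * π + l * π / 6) (by positivity))
  -- the interval of index `j + 1` lies to the left of the one of index `j`
  have hdisj : ∀ i j : ℕ, i < j → endpt l j ≤ endpt (l + 1) i := fun i j hij => by
    refine neg_le_neg (rpow_le_rpow (by positivity) ?_ (by norm_num))
    have h1 : (i : ℝ) + 1 ≤ j := by exact_mod_cast hij
    have h2 : ((i : ℝ) + 1) * π ≤ j * π := by gcongr
    push_cast
    linarith
  refine ⟨fun j => ⟨-liouville (σ j), ⟨hmem j, h0 j⟩, ?_⟩, fun x hx hfx => ?_, ?_,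
    fun x hx hfx => ?_, fun j => ?_, fun j => ?_⟩
  · rintro x ⟨hx, hfx⟩
    obtain ⟨i, rfl⟩ := hzero x (hx.2.trans (hend j)) hfx
    rcases lt_trichotomy i j with hij | rfl | hij
    · linarith [hx.2, hdisj i j hij, (hmem i).1]
    · rfl
    · linarith [hx.1, hdisj j i hij, (hmem i).2]
  · obtain ⟨j, rfl⟩ := hzero x hx hfx
    exact ⟨j, hmem j⟩
  · rwa [funext hseq]
  · obtain ⟨j, rfl⟩ := hzero x hx hfx
    exact ⟨j, by rw [hseq]⟩
  · rw [hseq]; exact h0 j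
  · rw [hseq]; exact hmem j

theorem airyC_even (j : ℕ) : airyC (2 * j) = negZeroSeq (deriv airyV) j := by
  simp [airyC]

theorem airyC_odd (j : ℕ) : airyC (2 * j + 1) = negZeroSeq airyV j := by
  have : (2 * j + 1) / 2 = j := by omega
  simp [airyC, this]

theorem airyCTilde_even (j : ℕ) : airyCTilde (2 * j) = negZeroSeq airyU j := by
  simp [airyCTilde]

theorem airyCTilde_odd (j : ℕ) : airyCTilde (2 * j + 1) = negZeroSeq (deriv airyU) j := by
  have : (2 * j + 1) / 2 = j := by omega
  simp [airyCTilde, this]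

end AiryZeros

open AiryZeros in
theorem mainTheorem9 :
    -- zeros of `v'`
    ((∀ j : ℕ, ∃! x : ℝ, x ∈ Set.Ioo (endpt 3 j) (endpt 2 j) ∧ deriv airyV x = 0) ∧
      (∀ x : ℝ, deriv airyV x = 0 → ∃ j : ℕ, x ∈ Set.Ioo (endpt 3 j) (endpt 2 j)) ∧
      StrictMono (fun j : ℕ => airyC (2 * j)) ∧
      {x : ℝ | deriv airyV x = 0} = Set.range (fun j : ℕ => -airyC (2 * j)) ∧
      (∀ j : ℕ, -airyC (2 * j) ∈ Set.Ioo (endpt 3 j) (endpt 2 j))) ∧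
    -- zeros of `u`
    ((∀ j : ℕ, ∃! x : ℝ, x ∈ Set.Ioo (endpt 4 j) (endpt 3 j) ∧ airyU x = 0) ∧
      (∀ x : ℝ, airyU x = 0 → ∃ j : ℕ, x ∈ Set.Ioo (endpt 4 j) (endpt 3 j)) ∧
      StrictMono (fun j : ℕ => airyCTilde (2 * j)) ∧
      {x : ℝ | airyU x = 0} = Set.range (fun j : ℕ => -airyCTilde (2 * j)) ∧
      (∀ j : ℕ, -airyCTilde (2 * j) ∈ Set.Ioo (endpt 4 j) (endpt 3 j))) ∧
    -- zeros of `v`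
    ((∀ j : ℕ, ∃! x : ℝ, x ∈ Set.Ioo (endpt 6 j) (endpt 5 j) ∧ airyV x = 0) ∧
      (∀ x : ℝ, airyV x = 0 → x = 0 ∨ ∃ j : ℕ, x ∈ Set.Ioo (endpt 6 j) (endpt 5 j)) ∧
      StrictMono (fun j : ℕ => airyC (2 * j + 1)) ∧
      {x : ℝ | airyV x = 0} = Set.range (fun j : ℕ => -airyC (2 * j + 1)) ∪ {0} ∧
      (∀ j : ℕ, -airyC (2 * j + 1) ∈ Set.Ioo (endpt 6 j) (endpt 5 j))) ∧
    -- zeros of `u'`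
    ((∀ j : ℕ, ∃! x : ℝ, x ∈ Set.Ioo (endpt 7 j) (endpt 6 j) ∧ deriv airyU x = 0) ∧
      (∀ x : ℝ, deriv airyU x = 0 → x = 0 ∨ ∃ j : ℕ, x ∈ Set.Ioo (endpt 7 j) (endpt 6 j)) ∧
      StrictMono (fun j : ℕ => airyCTilde (2 * j + 1)) ∧
      {x : ℝ | deriv airyU x = 0} = Set.range (fun j : ℕ => -airyCTilde (2 * j + 1)) ∪ {0} ∧
      (∀ j : ℕ, -airyCTilde (2 * j + 1) ∈ Set.Ioo (endpt 7 j) (endpt 6 j))) ∧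
    -- separation
    ∀ p : ℕ, -airyCTilde p < -airyC p := by
  obtain ⟨hU, hU0, hU1⟩ := airyU_spec
  obtain ⟨hV, hV0, hV1⟩ := airyV_spec
  obtain ⟨σ, τ, hσ, hwσ, hσ', hτ, hqτ, hτ'⟩ :=
    (airySystem_of_isAirySolution hU).exists_zeros_of_snd_eq_zero
      (by simp [liouville_zero, hU0]) (by simp [liouville_zero, hU1])
  obtain ⟨ρ, θ, hρ, hwρ, hρ', hθ, hqθ, hθ'⟩ :=
    ((airySystem_of_isAirySolution hV).const_mul (-1)).exists_zeros_of_fst_eq_zero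
      (by simp [liouville_zero, hV0]) (by simp [liouville_zero, hV1])
  simp only [neg_one_mul, neg_neg, neg_eq_zero] at hwρ hρ' hqθ hθ' hqτ hτ'
  obtain ⟨u1, u2, u3, u4, u5, u6⟩ :=
    negative_zeros (l := 3) (by norm_num) (by exact_mod_cast hσ) hwσ hσ'
  obtain ⟨du1, du2, du3, du4, du5, du6⟩ :=
    negative_zeros (l := 6) (by norm_num) (by exact_mod_cast hτ) hqτ hτ'
  obtain ⟨v1, v2, v3, v4, v5, v6⟩ :=
    negative_zeros (l := 5) (by norm_num) (by exact_mod_cast hρ) hwρ hρ'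
  obtain ⟨dv1, dv2, dv3, dv4, dv5, dv6⟩ :=
    negative_zeros (l := 2) (by norm_num) (by exact_mod_cast hθ) hqθ hθ'
  have uneg : ∀ x, airyU x = 0 → x < 0 := fun x hx => by
    by_contra! hcon
    rcases hcon.eq_or_lt with rfl | hpos
    · rw [hU0] at hx; exact one_ne_zero hx
    · simpa [hx] using airyU_mul_deriv_pos hpos
  have dvneg : ∀ x, deriv airyV x = 0 → x < 0 := fun x hx => by
    by_contra! hcon
    rcases hcon.eq_or_lt with rfl | hpos
    · rw [hV1] at hx; exact one_ne_zero hx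
    · simpa [hx] using airyV_mul_deriv_pos hpos
  have vneg : ∀ x, airyV x = 0 → x = 0 ∨ x < 0 := fun x hx => by
    by_contra! hcon
    simpa [hx] using airyV_mul_deriv_pos (hcon.2.lt_of_ne' hcon.1)
  have duneg : ∀ x, deriv airyU x = 0 → x = 0 ∨ x < 0 := fun x hx => by
    by_contra! hcon
    simpa [hx] using airyU_mul_deriv_pos (hcon.2.lt_of_ne' hcon.1)
  simp only [airyC_even, airyC_odd, airyCTilde_even, airyCTilde_odd]
  refine ⟨⟨dv1, fun x hx => dv2 x (dvneg x hx) hx, dv3, ?_, dv6⟩,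
    ⟨u1, fun x hx => u2 x (uneg x hx) hx, u3, ?_, u6⟩,
    ⟨v1, fun x hx => (vneg x hx).imp_right fun h => v2 x h hx, v3, ?_, v6⟩,
    ⟨du1, fun x hx => (duneg x hx).imp_right fun h => du2 x h hx, du3, ?_, du6⟩, fun p => ?_⟩
  · ext x
    refine ⟨fun hx => dv4 x (dvneg x hx) hx, ?_⟩
    rintro ⟨j, rfl⟩
    exact dv5 j
  · ext x
    refine ⟨fun hx => u4 x (uneg x hx) hx, ?_⟩
    rintro ⟨j, rfl⟩
    exact u5 j
  · ext x
    refine ⟨fun hx => (vneg x hx).symm.imp (fun h => v4 x h hx) id, ?_⟩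
    rintro (⟨j, rfl⟩ | rfl)
    · exact v5 j
    · exact hV0
  · ext x
    refine ⟨fun hx => (duneg x hx).symm.imp (fun h => du4 x h hx) id, ?_⟩
    rintro (⟨j, rfl⟩ | rfl)
    · exact du5 j
    · exact hU1
  · rcases Nat.even_or_odd' p with ⟨j, rfl | rfl⟩
    · rw [airyC_even, airyCTilde_even]
      exact (u6 j).2.trans (dv6 j).1
    · rw [airyC_odd, airyCTilde_odd]
      exact (du6 j).2.trans (v6 j).1
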